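/- Let $X$ be a complete separable metric space, $c\colon X\times X\to(-\infty,+\infty]$ lower semicontinuous and bounded below, $\varepsilon>0$, $p>0$, $\mu_0,\mu_1$ finite nonnegative Borel measures on $X$ and $\nu_X$ a finite nonnegative Borel measure on $X\times X$. Write $\mathcal M(Z)$ for the finite nonnegative Borel measures on $Z$. Let $F(s)=s\log s-s+1$ (so $F(0)=1$, $F'_\infty=\lim_{s\to\infty}F(s)/s=+\infty$) and, for measures $\gamma=\sigma\mu+\gamma^\perp$ (Lebesgue decomposition), $\mathcal F(\gamma\mid\mu)=\int F(\sigma)\,d\mu+F'_\infty\,\gamma^\perp(Z)$, with $\infty\cdot 0=0$. With $\gamma_0,\gamma_1$ the marginals of $\gamma$, define $$\mathrm{UOT}_{X,\varepsilon}(\mu_0,\mu_1)=\inf_{\gamma\in\mathcal M(X\times X)}\Big\{\mathcal F(\gamma_0\mid\mu_0)+\mathcal F(\gamma_1\mid\mu_1)+\int c\,d\gamma+\varepsilon\,\mathcal F(\gamma\mid\nu_X)\Big\}.$$ Let $R(s)=sF(1/s)$ for $s>0$, $R(0)=F'_\infty=+\infty$, and $$H_\varepsilon(x_0,s_0,x_1,s_1,S)=\inf_{t\ge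 0}\; t\Big(R\big(\tfrac{s_0}{t}\big)+R\big(\tfrac{s_1}{t}\big)+\varepsilon R\big(\tfrac{S}{t}\big)+c(x_0,x_1)\Big),$$ where the expression at $t=0$ is understood as $F(0)(s_0+s_1+\varepsilon S)$; equivalently $H_\varepsilon=s_0+s_1+\varepsilon S-(2+\varepsilon)(s_0s_1)^{\frac1{2+\varepsilon}}S^{\frac{\varepsilon}{2+\varepsilon}}e^{-c(x_0,x_1)/(2+\varepsilon)}$. Let $Y=X\times[0,\infty)$, let $(x_0,s_0,x_1,s_1,S)$ denote points of $Y\times Y\times[0,\infty)$, and put $H^\varepsilon_p(x_0,s_0,x_1,s_1,S)=H_\varepsilon(x_0,s_0^p,x_1,s_1^p,S^p)$. For $\eta\in\mathcal M(Y\times Y\times[0,\infty))$ let $\mathsf h_i^p\eta=\pi^{x_i}_\#(s_i^p\eta)$, $\mathsf H^p\eta=\pi^{(x_0,x_1)}_\#(S^p\eta)$, $(H^\varepsilon_p,\eta)=\int H^\varepsilon_p\,d\eta$, and $$S^p_{\le}=\{\eta:\mathsf h_i^p\eta\le\mu_i\ (i=0,1),\ \mathsf H^p\eta\le\nu_X\},\qquad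 S^p_{=}=\{\eta:\mathsf h_i^p\eta=\mu_i\ (i=0,1),\ \mathsf H^p\eta=\nu_X\}.$$ Then $$\mathrm{UOT}_{X,\varepsilon}(\mu_0,\mu_1)=\inf_{\eta\in S^p_{\le}}\Big\{(H^\varepsilon_p,\eta)+F(0)\Big(\sum_{i=0,1}(\mu_i-\mathsf h_i^p\eta)(X)+\varepsilon\,(\nu_X-\mathsf H^p\eta)(X\times X)\Big)\Big\}=\inf_{\eta\in S^p_{=}}(H^\varepsilon_p,\eta).$$ Moreover, if $\varepsilon\le 1$, the first equality also holds with the factor $\varepsilon$ in front of $(\nu_X-\mathsf H^p\eta)(X\times X)$ replaced by $1$. -/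

import Mathlib

open MeasureTheory Filter Topology
open scoped ENNReal NNReal

noncomputable section

namespace RegUOT

/-- The Kullback-Leibler entropy function `F(s) = s log s - s + 1` on `[0, ∞)`. -/
def F (s : ℝ≥0) : ℝ≥0∞ := ENNReal.ofReal ((s : ℝ) * Real.log s - s + 1)

/-- The recession constant `lim_{s → ∞} F(s) / s`; its value is justified by
`tendsto_F_div_self`. -/
def FInfty : ℝ≥0∞ := ⊤

theorem tendsto_F_div_self :
    Tendsto (fun s : ℝ≥0 => F s / (s : ℝ≥0∞)) atTop (𝓝 FInfty) := by
  rw [FInfty, ENNReal.tendsto_nhds_top_iff_nnreal]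
  intro K
  have h1 : Tendsto (fun s : ℝ≥0 => Real.log (s : ℝ) - 1) atTop atTop :=
    tendsto_atTop_add_const_right _ _
      (Real.tendsto_log_atTop.comp (NNReal.tendsto_coe_atTop.2 tendsto_id))
  filter_upwards [h1.eventually_gt_atTop (K : ℝ), eventually_gt_atTop 0] with s hs hs0
  have hs0' : (0 : ℝ) < s := by exact_mod_cast hs0
  rw [ENNReal.lt_div_iff_mul_lt (Or.inl (by exact_mod_cast hs0.ne')) (Or.inl ENNReal.coe_ne_top)]
  rw [F, ← ENNReal.coe_mul, ENNReal.ofReal, ENNReal.coe_lt_coe, Real.lt_toNNReal_iff_coe_lt]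
  push_cast
  nlinarith

/-- The relative entropy functional `∫ F(σ) dμ + F'_∞ γ^⊥(Z)`, where `γ = σ μ + γ^⊥` is the
Lebesgue decomposition of `γ` with respect to `μ`. -/
def entropy {Z : Type*} [MeasurableSpace Z] (γ μ : Measure Z) : ℝ≥0∞ :=
  (∫⁻ z, F (γ.rnDeriv μ z).toNNReal ∂μ) + FInfty * γ.singularPart μ Set.univ

/-- The integral `∫ f⁺ dμ - ∫ f⁻ dμ` of an extended real valued function
(used only where `∫ f⁻ dμ < ∞`). -/
def eintegral {Z : Type*} [MeasurableSpace Z] (μ : Measure Z) (f : Z → EReal) : EReal :=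
  ((∫⁻ z, (f z).toENNReal ∂μ : ℝ≥0∞) : EReal) - ((∫⁻ z, (-f z).toENNReal ∂μ : ℝ≥0∞) : EReal)

/-- The regularised primal functional
`F(γ₀ | μ₀) + F(γ₁ | μ₁) + (c, γ) + ε F(γ | ν)`. -/
def primal {X : Type*} [MeasurableSpace X] (c : X × X → EReal) (ε : ℝ)
    (μ₀ μ₁ : Measure X) (ν : Measure (X × X)) (γ : Measure (X × X)) : EReal :=
  (entropy (γ.map Prod.fst) μ₀ : EReal) + (entropy (γ.map Prod.snd) μ₁ : EReal)
    + eintegral γ c + ((ENNReal.ofReal ε * entropy γ ν : ℝ≥0∞) : EReal)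

/-- The original-space regularised unbalanced optimal transport problem: the infimum of the
regularised primal functional over all finite measures on `X × X`. -/
def UOT {X : Type*} [MeasurableSpace X] (c : X × X → EReal) (ε : ℝ)
    (μ₀ μ₁ : Measure X) (ν : Measure (X × X)) : EReal :=
  ⨅ γ ∈ {γ : Measure (X × X) | IsFiniteMeasure γ}, primal c ε μ₀ μ₁ ν γ

/-- The reverse entropy `R(s) = s F(1/s)` for `s > 0`, `R(0) = F'_∞`. -/
def R (s : ℝ≥0) : ℝ≥0∞ := if s = 0 then FInfty else s * F (1 / s)

/-- The perspective function `(s, t) ↦ t R(s/t)` of `R`, extended to `t = 0` as usual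
by the recession function `s ↦ R'_∞ s = F(0) s`. -/
def persp (s t : ℝ≥0) : ℝ≥0∞ := if t = 0 then F 0 * s else t * R (s / t)

/-- The regularised induced marginal perspective cost at a pair of points of cost `c`:
the infimum over `t` of `t (R(s₀/t) + R(s₁/t) + ε R(S/t) + c)`. The limiting value
`F(0) (s₀ + s₁ + ε S)` at `t = 0` is included; it does not affect the infimum when
`s₀, s₁, S > 0` and `c < ∞`, and it is what gives the correct value if a radial component
vanishes or `c = ∞`. -/
def pointCost (ε : ℝ) (c : EReal) (s₀ s₁ S : ℝ≥0) : EReal :=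
  ⨅ t : ℝ≥0, ((persp s₀ t + persp s₁ t + ENNReal.ofReal ε * persp S t : ℝ≥0∞) : EReal)
    + ((t : ℝ) : EReal) * c

/-- The extended space `Y × Y × ℝ₊` with `Y = X × ℝ₊`; points are
`((x₀, s₀), (x₁, s₁), S)`. -/
abbrev Ext (X : Type*) : Type _ := (X × ℝ≥0) × (X × ℝ≥0) × ℝ≥0

/-- The cost `H_p^ε(x₀, s₀, x₁, s₁, S) = H_ε(x₀, s₀^p, x₁, s₁^p, S^p)`. -/
def H {X : Type*} (c : X × X → EReal) (ε p : ℝ) (z : Ext X) : EReal :=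
  pointCost ε (c (z.1.1, z.2.1.1)) (z.1.2 ^ p) (z.2.1.2 ^ p) (z.2.2 ^ p)

/-- The homogeneous marginal `π^{x₀}_# (s₀^p η)`. -/
def h₀ {X : Type*} [MeasurableSpace X] (p : ℝ) (η : Measure (Ext X)) : Measure X :=
  (η.withDensity fun z => ((z.1.2 ^ p : ℝ≥0) : ℝ≥0∞)).map fun z => z.1.1

/-- The homogeneous marginal `π^{x₁}_# (s₁^p η)`. -/
def h₁ {X : Type*} [MeasurableSpace X] (p : ℝ) (η : Measure (Ext X)) : Measure X :=
  (η.withDensity fun z => ((z.2.1.2 ^ p : ℝ≥0) : ℝ≥0∞)).map fun z => z.2.1.1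

/-- The joint homogeneous marginal `π^{(x₀, x₁)}_# (S^p η)`. -/
def hJoint {X : Type*} [MeasurableSpace X] (p : ℝ) (η : Measure (Ext X)) : Measure (X × X) :=
  (η.withDensity fun z => ((z.2.2 ^ p : ℝ≥0) : ℝ≥0∞)).map fun z => (z.1.1, z.2.1.1)

/-- The finite measures on the extended space with homogeneous marginals at most
`μ₀, μ₁, ν`. -/
def SLe {X : Type*} [MeasurableSpace X] (p : ℝ) (μ₀ μ₁ : Measure X) (ν : Measure (X × X)) :
    Set (Measure (Ext X)) :=
  {η | IsFiniteMeasure η ∧ h₀ p η ≤ μ₀ ∧ h₁ p η ≤ μ₁ ∧ hJoint p η ≤ ν}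

/-- The finite measures on the extended space with homogeneous marginals equal to
`μ₀, μ₁, ν`. -/
def SEq {X : Type*} [MeasurableSpace X] (p : ℝ) (μ₀ μ₁ : Measure X) (ν : Measure (X × X)) :
    Set (Measure (Ext X)) :=
  {η | IsFiniteMeasure η ∧ h₀ p η = μ₀ ∧ h₁ p η = μ₁ ∧ hJoint p η = ν}

/-- The weighted mass defect
`F(0) ((μ₀ - h₀ η)(X) + (μ₁ - h₁ η)(X) + κ (ν - hJoint η)(X × X))`. -/
def defect {X : Type*} [MeasurableSpace X] (κ : ℝ≥0∞) (p : ℝ) (μ₀ μ₁ : Measure X)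
    (ν : Measure (X × X)) (η : Measure (Ext X)) : ℝ≥0∞ :=
  F 0 * ((μ₀ - h₀ p η) Set.univ + (μ₁ - h₁ p η) Set.univ
    + κ * (ν - hJoint p η) Set.univ)

end RegUOT

end

/-!
The proof compares the two problems through explicit competitors, after writing the cost as
`c = k - M` with `k ≥ 0` and a constant `M ≥ 0`, so that all estimates take place in `ℝ≥0∞`.

For `s > 0` one has `t R(s/t) = t log (t/s) - t + s`, hence the infimum over `t` defining the cost
`H` is attained at the explicit point `t = (s₀ s₁ S^ε e^{-c})^{1/(2+ε)}` (`optTime`,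
`objective_optTime_le`), which depends measurably on the data.

*The original value is at most the extended value with defect*
(`UOT_le_eintegral_add_defect`). Given `η` with homogeneous marginals below `μ₀, μ₁, ν`, let `γ`
be the projection of `t η` to `X × X`, where `t` is the minimiser. The transport terms agree, and
each entropy term is controlled by Jensen's inequality for push-forwards (`entropy_map_le`): the
entropy of `π_#(t η)` relative to `μ ≥ π_#(s η)` is at most `∫ t R(s/t) dη` plus the mass of
`μ - π_#(s η)`. It is obtained by integrating Fenchel's inequality
`t u + s ≤ t R(s/t) + s e^u` with the slopes `u = log σ`, where `σ` is the density of `π_#(t η)`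
with respect to `μ`, truncated to a compact subset of `(0, ∞)`, followed by Fatou's lemma.

*The extended value over exact marginals is at most the original value* (`iInf_SEq_le_UOT`). Given
`γ` of finite primal value, its marginals and `γ` itself have densities `σ₀, σ₁, σ` with respect to
`μ₀, μ₁, ν`. The plan `liftPlan` places `γ` at the radii `σ₀^{-1/p}, σ₁^{-1/p}, σ^{-1/p}`, and adds
the parts of `μ₀, μ₁, ν` where the densities vanish on points with a single nonzero radius. Testing
`H` with `t = 1` on the first piece and `t = 0` on the others gives the primal value of `γ`, since
the entropy is `∫ R(1/σ) dγ + μ {σ = 0}` (`lintegral_R_invDensity_add_uncovered`).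

Plans with exact marginals have no defect, so the infimum with defect, for any weight, is at most
the infimum over exact marginals; together with monotonicity of the defect in its weight this
closes the chain of inequalities.
-/

noncomputable section

namespace RegUOT

/-! ### Differences of extended nonnegative functions -/

/-- The integral of a difference of nonnegative functions is the difference of the integrals,
although the positive and negative parts of the difference may be smaller than the two terms. -/
theorem eintegral_coe_sub {Z : Type*} [MeasurableSpace Z] (μ : Measure Z) {g h : Z → ℝ≥0∞}
    (hg : Measurable g) (hh : Measurable h) (hfin : ∀ z, h z ≠ ⊤) (hint : ∫⁻ z, h z ∂μ ≠ ⊤) :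
    eintegral μ (fun z => (g z : EReal) - (h z : EReal))
      = ((∫⁻ z, g z ∂μ : ℝ≥0∞) : EReal) - ((∫⁻ z, h z ∂μ : ℝ≥0∞) : EReal) := by
  have h1 : ∀ z, ((g z : EReal) - (h z : EReal)).toENNReal = g z - h z := fun z => by
    rw [EReal.toENNReal_sub (EReal.coe_ennreal_nonneg _)]; simp
  have h2 : ∀ z, (-((g z : EReal) - (h z : EReal))).toENNReal = h z - g z := fun z => by
    rw [EReal.neg_sub (Or.inl (by simp)) (Or.inr (by simpa using hfin z)), add_comm, ← sub_eq_add_neg,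
      EReal.toENNReal_sub (EReal.coe_ennreal_nonneg _)]
    simp
  simp only [eintegral, h1, h2]
  have hB : ∫⁻ z, h z - g z ∂μ ≠ ⊤ :=
    ne_top_of_le_ne_top hint (lintegral_mono fun z => tsub_le_self)
  have key : ∫⁻ z, g z ∂μ + ∫⁻ z, h z - g z ∂μ = ∫⁻ z, h z ∂μ + ∫⁻ z, g z - h z ∂μ := by
    rw [← lintegral_add_left hg, ← lintegral_add_left hh]
    refine lintegral_congr fun z => ?_
    rcases le_total (g z) (h z) with hz | hz
    · rw [add_tsub_cancel_of_le hz, tsub_eq_zero_of_le hz, add_zero]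
    · rw [add_tsub_cancel_of_le hz, tsub_eq_zero_of_le hz, add_zero]
  generalize (∫⁻ z, g z ∂μ) = G at *
  generalize (∫⁻ z, h z ∂μ) = K at *
  generalize (∫⁻ z, g z - h z ∂μ) = A at *
  generalize (∫⁻ z, h z - g z ∂μ) = B at *
  lift B to ℝ≥0 using hB
  lift K to ℝ≥0 using hint
  induction A with
  | top =>
    have : G = ⊤ := by simpa using key
    simp [this]
  | coe A =>
    have hG : G ≠ ⊤ := fun hG => by
      rw [hG, top_add] at key
      exact ENNReal.coe_ne_top (by exact_mod_cast key.symm : ((K + A : ℝ≥0) : ℝ≥0∞) = ⊤)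
    lift G to ℝ≥0 using hG
    have key' : (G : ℝ) + B = K + A := by exact_mod_cast key
    simp only [EReal.coe_nnreal_eq_coe_real]
    rw [← EReal.coe_sub, ← EReal.coe_sub]
    congr 1
    linarith

theorem coe_sub_le_coe_sub {a b x y : ℝ≥0∞} (hx : x ≠ ⊤) (hy : y ≠ ⊤) (h : a + y ≤ b + x) :
    (a : EReal) - (x : EReal) ≤ (b : EReal) - (y : EReal) := by
  lift x to ℝ≥0 using hx
  lift y to ℝ≥0 using hy
  induction b with
  | top => simp
  | coe b =>
    have ha : a ≠ ⊤ := fun ha => by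
      rw [ha, top_add, top_le_iff] at h
      exact ENNReal.coe_ne_top (by exact_mod_cast h : ((b + x : ℝ≥0) : ℝ≥0∞) = ⊤)
    lift a to ℝ≥0 using ha
    have h' : (a : ℝ) + y ≤ b + x := by exact_mod_cast h
    simp only [EReal.coe_nnreal_eq_coe_real]
    rw [← EReal.coe_sub, ← EReal.coe_sub, EReal.coe_le_coe_iff]
    linarith

theorem coe_sub_le_coe_sub_add {a b d : ℝ≥0∞} (x : EReal) (h : a ≤ b + d) :
    (a : EReal) - x ≤ (b : EReal) - x + (d : EReal) := by
  rw [sub_eq_add_neg, sub_eq_add_neg, add_right_comm, ← EReal.coe_ennreal_add]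
  exact add_le_add_left (EReal.coe_ennreal_le_coe_ennreal_iff.2 h) _

/-! ### The perspective function -/

theorem F_zero : F 0 = 1 := by simp [F]

theorem measurable_F : Measurable F := by
  unfold F
  fun_prop

theorem measurable_R : Measurable R := by
  unfold R
  refine Measurable.ite (measurableSet_singleton 0) measurable_const ?_
  exact measurable_coe_nnreal_ennreal.mul (measurable_F.comp (measurable_const.div measurable_id))

theorem _root_.Measurable.regUOT_persp {α : Type*} [MeasurableSpace α] {s t : α → ℝ≥0}
    (hs : Measurable s) (ht : Measurable t) : Measurable fun a => persp (s a) (t a) := by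
  unfold persp
  refine Measurable.ite (ht (measurableSet_singleton 0)) ?_ ?_
  · exact hs.coe_nnreal_ennreal.const_mul _
  · exact ht.coe_nnreal_ennreal.mul (measurable_R.comp (hs.div ht))

theorem persp_zero_right (s : ℝ≥0) : persp s 0 = s := by simp [persp, F_zero]

theorem persp_zero_left {t : ℝ≥0} (ht : t ≠ 0) : persp 0 t = ⊤ := by
  simp [persp, R, FInfty, ht]

theorem persp_one_right (s : ℝ≥0) : persp s 1 = R s := by simp [persp]

theorem persp_of_ne_zero {s : ℝ≥0} (hs : s ≠ 0) (t : ℝ≥0) :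
    persp s t = ENNReal.ofReal ((t : ℝ) * Real.log t - t * Real.log s - t + s) := by
  rcases eq_or_ne t 0 with rfl | ht
  · simp [persp_zero_right]
  have hs' : (0 : ℝ) < s := by positivity
  have ht' : (0 : ℝ) < t := by positivity
  have hst : (t : ℝ≥0∞) * ((s / t : ℝ≥0) : ℝ≥0∞) = ENNReal.ofReal s := by
    rw [← ENNReal.coe_mul, mul_div_cancel₀ _ ht, ENNReal.ofReal_coe_nnreal]
  rw [persp, if_neg ht, R, if_neg (by positivity), ← mul_assoc, hst, F,
    ← ENNReal.ofReal_mul hs'.le]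
  congr 1
  push_cast
  rw [one_div_div, Real.log_div ht'.ne' hs'.ne']
  field_simp

/-- The inequality `a log b ≤ a log a - a + b` behind the convex duality of the entropy, in a
form that also covers `a = 0`. -/
theorem mul_log_le {a b : ℝ} (ha : 0 ≤ a) (hb : 0 < b) :
    a * Real.log b ≤ a * Real.log a - a + b := by
  rcases ha.eq_or_lt with rfl | ha
  · simpa using hb.le
  have h := Real.log_le_sub_one_of_pos (div_pos hb ha)
  rw [Real.log_div hb.ne' ha.ne'] at h
  have h2 := mul_le_mul_of_nonneg_left h ha.le
  have h3 : a * (b / a - 1) = b - a := by field_simp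
  linarith

/-- Fenchel's inequality for the perspective function at slope `u`, with the negative part of
`t * u` moved to the other side so that it can be integrated in `ℝ≥0∞`. -/
theorem fenchel_persp (s t : ℝ≥0) (u : ℝ) :
    (t : ℝ≥0∞) * ENNReal.ofReal u + s
      ≤ persp s t + s * ENNReal.ofReal (Real.exp u) + t * ENNReal.ofReal (-u) := by
  rcases eq_or_ne s 0 with rfl | hs
  · rcases eq_or_ne t 0 with rfl | ht
    · simp
    · simp [persp_zero_left ht]
  have hs' : (0 : ℝ) < s := by positivity
  have hp := mul_log_le t.coe_nonneg (mul_pos hs' (Real.exp_pos u))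
  rw [Real.log_mul hs'.ne' (Real.exp_pos u).ne', Real.log_exp] at hp
  have hpos : 0 ≤ (t : ℝ) * Real.log t - t * Real.log s - t + s := by
    have := mul_log_le t.coe_nonneg hs'
    linarith
  rw [persp_of_ne_zero hs]
  have e : ∀ a : ℝ≥0, (a : ℝ≥0∞) = ENNReal.ofReal a := fun a => by simp
  rcases le_total 0 u with hu | hu
  · rw [ENNReal.ofReal_of_nonpos (neg_nonpos.2 hu), mul_zero, add_zero, e t, e s,
      ← ENNReal.ofReal_mul t.coe_nonneg, ← ENNReal.ofReal_mul s.coe_nonneg, ← ENNReal.ofReal_add (by positivity) s.coe_nonneg,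
      ← ENNReal.ofReal_add hpos (by positivity)]
    exact ENNReal.ofReal_le_ofReal (by linarith)
  · rw [ENNReal.ofReal_of_nonpos hu, mul_zero, zero_add, e t, e s,
      ← ENNReal.ofReal_mul t.coe_nonneg, ← ENNReal.ofReal_mul s.coe_nonneg,
      ← ENNReal.ofReal_add hpos (by positivity),
      ← ENNReal.ofReal_add (by positivity) (mul_nonneg t.coe_nonneg (neg_nonneg.2 hu))]
    exact ENNReal.ofReal_le_ofReal (by linarith)

/-! ### The pointwise minimisation problem -/

/-- The objective minimised over `t` in the induced marginal perspective cost, for a nonnegative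
base cost `k`. -/
def objective (ε : ℝ) (k : ℝ≥0∞) (s₀ s₁ S t : ℝ≥0) : ℝ≥0∞ :=
  persp s₀ t + persp s₁ t + ENNReal.ofReal ε * persp S t + t * k

/-- The minimiser `t = (s₀ s₁ S^ε e^{-c})^{1/(2+ε)}` for the cost `c = k - M`, read as `0` if a
radial component vanishes or `k = ∞`. -/
def optTime (ε : ℝ) (M : ℝ≥0) (k : ℝ≥0∞) (s₀ s₁ S : ℝ≥0) : ℝ≥0 :=
  if s₀ = 0 ∨ s₁ = 0 ∨ S = 0 ∨ k = ⊤ then 0 else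
    Real.toNNReal (Real.exp ((Real.log s₀ + Real.log s₁ + ε * Real.log S - (k.toReal - M))
      / (2 + ε)))

theorem objective_zero (ε : ℝ) (k : ℝ≥0∞) (s₀ s₁ S : ℝ≥0) :
    objective ε k s₀ s₁ S 0 = s₀ + s₁ + ENNReal.ofReal ε * S := by
  simp [objective, persp_zero_right]

theorem objective_optTime_le {ε : ℝ} (hε : 0 < ε) (M : ℝ≥0) (k : ℝ≥0∞) (s₀ s₁ S t : ℝ≥0) :
    objective ε k s₀ s₁ S (optTime ε M k s₀ s₁ S) + (M * t : ℝ≥0)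
      ≤ objective ε k s₀ s₁ S t + (M * optTime ε M k s₀ s₁ S : ℝ≥0) := by
  by_cases hdeg : s₀ = 0 ∨ s₁ = 0 ∨ S = 0 ∨ k = ⊤
  · rw [optTime, if_pos hdeg]
    rcases eq_or_ne t 0 with rfl | ht
    · exact le_rfl
    have htop : objective ε k s₀ s₁ S t = ⊤ := by
      rcases hdeg with rfl | rfl | rfl | rfl <;>
        simp [objective, persp_zero_left ht, ENNReal.mul_top, ht, hε]
    simp [htop]
  set τ := optTime ε M k s₀ s₁ S with hτ
  rw [optTime, if_neg hdeg] at hτ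
  push Not at hdeg
  obtain ⟨h0, h1, h2, hk⟩ := hdeg
  lift k to ℝ≥0 using hk
  have hτpos : (0 : ℝ) < τ := by rw [hτ, Real.coe_toNNReal _ (Real.exp_pos _).le]; positivity
  have hlog : (2 + ε) * Real.log τ
      = Real.log s₀ + Real.log s₁ + ε * Real.log S - (k - M) := by
    rw [hτ, Real.coe_toNNReal _ (Real.exp_pos _).le, Real.log_exp, ENNReal.coe_toReal]
    field_simp
  have hnn : ∀ (s : ℝ≥0), s ≠ 0 → ∀ r : ℝ≥0,
      0 ≤ (r : ℝ) * Real.log r - r * Real.log s - r + s := fun s hs r => by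
    have := mul_log_le r.coe_nonneg (show (0 : ℝ) < s by positivity)
    linarith
  have hobj : ∀ r x : ℝ≥0, objective ε k s₀ s₁ S r + (x : ℝ≥0) = ENNReal.ofReal
      (((r : ℝ) * Real.log r - r * Real.log s₀ - r + s₀)
        + ((r : ℝ) * Real.log r - r * Real.log s₁ - r + s₁)
        + ε * ((r : ℝ) * Real.log r - r * Real.log S - r + S) + r * k + x) := fun r x => by
    have e : ∀ a : ℝ≥0, (a : ℝ≥0∞) = ENNReal.ofReal a := fun a => by simp
    have a0 := hnn s₀ h0 r
    have a1 := hnn s₁ h1 r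
    have a2 := mul_nonneg hε.le (hnn S h2 r)
    rw [objective, persp_of_ne_zero h0, persp_of_ne_zero h1, persp_of_ne_zero h2,
      ← ENNReal.ofReal_mul hε.le, ← ENNReal.ofReal_add a0 a1,
      ← ENNReal.ofReal_add (add_nonneg a0 a1) a2, e r, e k, e x, ← ENNReal.ofReal_mul r.coe_nonneg,
      ← ENNReal.ofReal_add (add_nonneg (add_nonneg a0 a1) a2) (by positivity),
      ← ENNReal.ofReal_add (add_nonneg (add_nonneg (add_nonneg a0 a1) a2) (by positivity)) x.coe_nonneg]
  rw [hobj, hobj]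
  refine ENNReal.ofReal_le_ofReal ?_
  -- Up to the shift by `M`, the gap between the two sides is `(2 + ε)` times the entropy of `t`
  -- relative to the minimiser.
  have hgap := mul_le_mul_of_nonneg_left (mul_log_le t.coe_nonneg hτpos) (show 0 ≤ 2 + ε by linarith)
  have hl1 : (2 + ε) * ((τ : ℝ) * Real.log τ) = τ * ((2 + ε) * Real.log τ) := by ring
  have hl2 : (2 + ε) * ((t : ℝ) * Real.log τ) = t * ((2 + ε) * Real.log τ) := by ring
  rw [hlog] at hl1 hl2
  push_cast
  linarith

theorem optTime_le {ε : ℝ} (hε : 0 < ε) (M : ℝ≥0) (k : ℝ≥0∞) (s₀ s₁ S : ℝ≥0) :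
    (optTime ε M k s₀ s₁ S : ℝ≥0∞)
      ≤ s₀ * ENNReal.ofReal (Real.exp (M + 1)) + s₁ + ENNReal.ofReal ε * S := by
  have h := objective_optTime_le hε M k s₀ s₁ S 0
  set t := optTime ε M k s₀ s₁ S
  have hF := fenchel_persp s₀ t (M + 1)
  rw [ENNReal.ofReal_of_nonpos (by linarith [M.coe_nonneg] : -((M : ℝ) + 1) ≤ 0), mul_zero, add_zero,
    ENNReal.ofReal_add M.coe_nonneg zero_le_one, ENNReal.ofReal_one,
    ENNReal.ofReal_coe_nnreal] at hF
  rw [objective_zero, mul_zero, ENNReal.coe_zero, add_zero, objective] at h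
  have hA : (s₀ : ℝ≥0∞) + (M * t : ℝ≥0) ≠ ⊤ := by
    rw [← ENNReal.coe_add]; exact ENNReal.coe_ne_top
  refine (ENNReal.add_le_add_iff_left hA).1 ?_
  push_cast at h ⊢
  calc (s₀ : ℝ≥0∞) + M * t + t = t * (M + 1) + s₀ := by ring
    _ ≤ persp s₀ t + s₀ * ENNReal.ofReal (Real.exp (M + 1)) := hF
    _ ≤ persp s₀ t + persp s₁ t + ENNReal.ofReal ε * persp S t + t * k
        + s₀ * ENNReal.ofReal (Real.exp (M + 1)) := by
      gcongr
      rw [add_assoc, add_assoc]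
      exact le_self_add
    _ ≤ s₀ + s₁ + ENNReal.ofReal ε * S + M * t + s₀ * ENNReal.ofReal (Real.exp (M + 1)) := by
      gcongr
    _ = _ := by ring

theorem coe_mul_sub (t M : ℝ≥0) (k : ℝ≥0∞) :
    ((t : ℝ) : EReal) * ((k : EReal) - ((M : ℝ) : EReal))
      = ((t * k : ℝ≥0∞) : EReal) - (((M * t : ℝ≥0) : ℝ≥0∞) : EReal) := by
  induction k with
  | top =>
    rcases eq_or_ne t 0 with rfl | ht
    · simp
    · have ht' : (0 : ℝ) < t := by positivity
      rw [EReal.coe_ennreal_top, EReal.top_sub_coe, EReal.coe_mul_top_of_pos ht',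
        ENNReal.mul_top (by simpa using ht), EReal.coe_ennreal_top]
      rfl
  | coe k =>
    rw [← ENNReal.coe_mul]
    simp only [EReal.coe_nnreal_eq_coe_real]
    rw [← EReal.coe_sub, ← EReal.coe_sub, ← EReal.coe_mul]
    congr 1
    push_cast
    ring

theorem pointCost_eq {ε : ℝ} (hε : 0 < ε) (M : ℝ≥0) (k : ℝ≥0∞) (s₀ s₁ S : ℝ≥0) :
    pointCost ε ((k : EReal) - ((M : ℝ) : EReal)) s₀ s₁ S
      = (objective ε k s₀ s₁ S (optTime ε M k s₀ s₁ S) : EReal)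
        - (((M * optTime ε M k s₀ s₁ S : ℝ≥0) : ℝ≥0∞) : EReal) := by
  have hterm : ∀ t : ℝ≥0,
      ((persp s₀ t + persp s₁ t + ENNReal.ofReal ε * persp S t : ℝ≥0∞) : EReal)
          + ((t : ℝ) : EReal) * ((k : EReal) - ((M : ℝ) : EReal))
        = (objective ε k s₀ s₁ S t : EReal) - (((M * t : ℝ≥0) : ℝ≥0∞) : EReal) := fun t => by
    rw [coe_mul_sub, objective, EReal.coe_ennreal_add _ ((t : ℝ≥0∞) * k), sub_eq_add_neg _ (_ : EReal),
      sub_eq_add_neg _ (_ : EReal), ← add_assoc]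
  simp only [pointCost, hterm]
  exact le_antisymm (iInf_le _ _) (le_iInf fun t =>
    coe_sub_le_coe_sub ENNReal.coe_ne_top ENNReal.coe_ne_top
      (objective_optTime_le hε M k s₀ s₁ S t))

/-! ### Entropy of push-forwards -/

theorem lintegral_withDensity_coe {E : Type*} [MeasurableSpace E] (η : Measure E) {w : E → ℝ≥0}
    (hw : Measurable w) {f : E → ℝ≥0∞} (hf : Measurable f) :
    ∫⁻ e, f e ∂(η.withDensity fun e => (w e : ℝ≥0∞)) = ∫⁻ e, w e * f e ∂η :=
  lintegral_withDensity_eq_lintegral_mul _ hw.coe_nnreal_ennreal hf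

theorem lintegral_map_withDensity_coe {E Z : Type*} [MeasurableSpace E] [MeasurableSpace Z]
    (η : Measure E) {π : E → Z} (hπ : Measurable π) {w : E → ℝ≥0} (hw : Measurable w)
    {f : Z → ℝ≥0∞} (hf : Measurable f) :
    ∫⁻ z, f z ∂((η.withDensity fun e => (w e : ℝ≥0∞)).map π) = ∫⁻ e, w e * f (π e) ∂η := by
  rw [lintegral_map hf hπ]
  exact lintegral_withDensity_coe η hw (hf.comp hπ)

/-- A measurable slope function `u = log a` gives the bound
`∫ (σ log a - a + 1) dμ ≤ ∫ persp s t dη + (μ - π_#(s η))(Z)`, where `σ` is the density of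
`π_#(t η)`. This is the integrated Fenchel inequality. -/
theorem lintegral_slope_le {E Z : Type*} [MeasurableSpace E] [MeasurableSpace Z] (η : Measure E)
    (μ : Measure Z) [IsFiniteMeasure μ] {π : E → Z} (hπ : Measurable π) {s t : E → ℝ≥0}
    (hs : Measurable s) (ht : Measurable t)
    (hle : (η.withDensity fun e => (s e : ℝ≥0∞)).map π ≤ μ)
    (hfin : ∫⁻ e, (t e : ℝ≥0∞) ∂η ≠ ⊤) {σ : Z → ℝ≥0} (hσ : Measurable σ)
    (hdens : (η.withDensity fun e => (t e : ℝ≥0∞)).map π = μ.withDensity fun z => (σ z : ℝ≥0∞))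
    {a : Z → ℝ} (ha : Measurable a) {δ K : ℝ} (hδ : 0 < δ) (hδa : ∀ z, δ ≤ a z)
    (haK : ∀ z, a z ≤ K) (hpos : ∀ z, 0 ≤ σ z * Real.log (a z) - a z + 1) :
    ∫⁻ z, ENNReal.ofReal (σ z * Real.log (a z) - a z + 1) ∂μ
      ≤ ∫⁻ e, persp (s e) (t e) ∂η
        + (μ - (η.withDensity fun e => (s e : ℝ≥0∞)).map π) Set.univ := by
  set h := (η.withDensity fun e => (s e : ℝ≥0∞)).map π with hh
  have : IsFiniteMeasure h := isFiniteMeasure_of_le μ hle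
  have ha0 : ∀ z, 0 < a z := fun z => hδ.trans_le (hδa z)
  have hu : Measurable fun z => Real.log (a z) := Real.measurable_log.comp ha
  have hcv : ∀ {w : E → ℝ≥0}, Measurable w → ∀ {f : Z → ℝ≥0∞}, Measurable f →
      ∫⁻ e, w e * f (π e) ∂η
        = ∫⁻ z, f z ∂((η.withDensity fun e => (w e : ℝ≥0∞)).map π) := fun {w} hw {f} hf =>
    (lintegral_map_withDensity_coe η hπ hw hf).symm
  have hcvσ : ∀ {f : Z → ℝ≥0∞}, Measurable f →
      ∫⁻ e, t e * f (π e) ∂η = ∫⁻ z, σ z * f z ∂μ := fun {f} hf => by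
    rw [hcv ht hf, hdens, lintegral_withDensity_coe μ hσ hf]
  set I := ∫⁻ e, persp (s e) (t e) ∂η
  have hμ : ∀ f : Z → ℝ≥0∞, ∫⁻ z, f z ∂μ = ∫⁻ z, f z ∂(μ - h) + ∫⁻ z, f z ∂h := fun f => by
    rw [← lintegral_add_measure, Measure.sub_add_cancel_of_le hle]
  have m1 : Measurable fun z => ENNReal.ofReal (Real.log (a z)) := hu.ennreal_ofReal
  have m2 : Measurable fun z => ENNReal.ofReal (-Real.log (a z)) := hu.neg.ennreal_ofReal
  have m3 : Measurable fun z => ENNReal.ofReal (a z) := ha.ennreal_ofReal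
  have hmP := hs.regUOT_persp ht
  have m4 : Measurable fun e => (t e : ℝ≥0∞) * ENNReal.ofReal (Real.log (a (π e))) :=
    ht.coe_nnreal_ennreal.mul (m1.comp hπ)
  have m5 : Measurable fun e => (s e : ℝ≥0∞) * ENNReal.ofReal (a (π e)) :=
    hs.coe_nnreal_ennreal.mul (m3.comp hπ)
  have m6 : Measurable fun z => (σ z : ℝ≥0∞) * ENNReal.ofReal (Real.log (a z)) :=
    hσ.coe_nnreal_ennreal.mul m1
  have m7 : Measurable fun z => (σ z : ℝ≥0∞) * ENNReal.ofReal (-Real.log (a z)) :=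
    hσ.coe_nnreal_ennreal.mul m2
  have step1 : ∫⁻ z, σ z * ENNReal.ofReal (Real.log (a z)) ∂μ + h Set.univ
      ≤ I + ∫⁻ z, ENNReal.ofReal (a z) ∂h
        + ∫⁻ z, σ z * ENNReal.ofReal (-Real.log (a z)) ∂μ := by
    have hone : h Set.univ = ∫⁻ e, (s e : ℝ≥0∞) * 1 ∂η := by
      rw [hcv hs (f := fun _ => 1) measurable_const, lintegral_one]
    rw [hone, ← hcvσ m1, ← hcvσ m2, ← hcv hs m3,
      ← lintegral_add_left m4, ← lintegral_add_left hmP, ← lintegral_add_left (hmP.fun_add m5)]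
    refine lintegral_mono fun e => ?_
    have := fenchel_persp (s e) (t e) (Real.log (a (π e)))
    rwa [Real.exp_log (ha0 _), ← mul_one (s e : ℝ≥0∞), mul_assoc, one_mul] at this
  have hQ : ∫⁻ z, σ z * ENNReal.ofReal (-Real.log (a z)) ∂μ ≠ ⊤ := by
    rw [← hcvσ m2]
    refine ne_top_of_le_ne_top (ENNReal.mul_ne_top hfin
      (ENNReal.ofReal_ne_top (r := -Real.log δ))) ?_
    rw [← lintegral_mul_const _ ht.coe_nnreal_ennreal]
    gcongr
    exact hδa _
  have hA : ∫⁻ z, ENNReal.ofReal (a z) ∂μ ≠ ⊤ := by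
    refine ne_top_of_le_ne_top (ENNReal.mul_ne_top (ENNReal.ofReal_ne_top (r := K))
      (measure_ne_top μ Set.univ)) ?_
    rw [← lintegral_const]
    exact lintegral_mono fun z => ENNReal.ofReal_le_ofReal (haK z)
  refine (ENNReal.add_le_add_iff_right (ENNReal.add_ne_top.2 ⟨hA, hQ⟩)).1 ?_
  have hptw : ∫⁻ z, ENNReal.ofReal (σ z * Real.log (a z) - a z + 1) ∂μ
      + (∫⁻ z, ENNReal.ofReal (a z) ∂μ + ∫⁻ z, σ z * ENNReal.ofReal (-Real.log (a z)) ∂μ)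
      = ∫⁻ z, σ z * ENNReal.ofReal (Real.log (a z)) ∂μ + μ Set.univ := by
    rw [← lintegral_one, ← lintegral_add_left m3,
      ← lintegral_add_left m6, ← lintegral_add_right _ (m3.fun_add m7)]
    refine lintegral_congr fun z => ?_
    have e : (σ z : ℝ≥0∞) = ENNReal.ofReal (σ z) := by simp
    rw [e, ← ENNReal.ofReal_mul (σ z).coe_nonneg, ← ENNReal.ofReal_mul (σ z).coe_nonneg, ← ENNReal.ofReal_one]
    rcases le_total 0 (Real.log (a z)) with hl | hl
    · have h1 := mul_nonneg (σ z).coe_nonneg hl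
      rw [ENNReal.ofReal_of_nonpos (p := (σ z : ℝ) * -Real.log (a z)) (by linarith), add_zero,
        ← ENNReal.ofReal_add (hpos z) (ha0 z).le, ← ENNReal.ofReal_add h1 zero_le_one]
      congr 1; ring
    · have h1 := mul_nonneg (σ z).coe_nonneg (neg_nonneg.2 hl)
      rw [ENNReal.ofReal_of_nonpos (p := (σ z : ℝ) * Real.log (a z)) (by linarith), zero_add,
        ← ENNReal.ofReal_add (ha0 z).le h1,
        ← ENNReal.ofReal_add (hpos z) (add_nonneg (ha0 z).le h1)]
      congr 1; ring
  rw [hptw]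
  have hμ1 := hμ fun _ => 1
  simp only [lintegral_one] at hμ1
  calc ∫⁻ z, σ z * ENNReal.ofReal (Real.log (a z)) ∂μ + μ Set.univ
      = (μ - h) Set.univ
        + (∫⁻ z, σ z * ENNReal.ofReal (Real.log (a z)) ∂μ + h Set.univ) := by
        rw [hμ1]; ring
    _ ≤ (μ - h) Set.univ + (I + ∫⁻ z, ENNReal.ofReal (a z) ∂h
        + ∫⁻ z, σ z * ENNReal.ofReal (-Real.log (a z)) ∂μ) := by gcongr
    _ ≤ (μ - h) Set.univ + (I + ∫⁻ z, ENNReal.ofReal (a z) ∂μ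
        + ∫⁻ z, σ z * ENNReal.ofReal (-Real.log (a z)) ∂μ) := by
        gcongr
    _ = _ := by ring

/-- Truncating `x` to `[1 / (n + 1), n + 1]`. -/
def truncate (n : ℕ) (x : ℝ) : ℝ := max (1 / ((n : ℝ) + 1)) (min x (n + 1))

theorem slope_truncate_nonneg (n : ℕ) (x : ℝ) :
    0 ≤ x * Real.log (truncate n x) - truncate n x + 1 := by
  have hn : (1 : ℝ) / (n + 1) ≤ 1 := by
    rw [div_le_one (by positivity)]; linarith [(Nat.cast_nonneg n : (0 : ℝ) ≤ n)]
  have hn1 : (1 : ℝ) ≤ n + 1 := by linarith [(Nat.cast_nonneg n : (0 : ℝ) ≤ n)]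
  have ha : 0 < truncate n x := lt_max_of_lt_left (by positivity)
  have hlog : truncate n x - 1 ≤ truncate n x * Real.log (truncate n x) := by
    have h := mul_le_mul_of_nonneg_left (Real.one_sub_inv_le_log_of_pos ha) ha.le
    rwa [mul_sub, mul_one, mul_inv_cancel₀ ha.ne'] at h
  -- The truncation lies between `1` and `x`, so replacing it by `x` in front of the logarithm
  -- only increases the product.
  suffices truncate n x * Real.log (truncate n x) ≤ x * Real.log (truncate n x) by linarith
  rcases le_total 1 x with h1 | h1
  · have : 1 ≤ truncate n x := le_max_of_le_right (le_min h1 hn1)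
    exact mul_le_mul_of_nonneg_right (max_le (hn.trans h1) (min_le_left _ _))
      (Real.log_nonneg this)
  · have : truncate n x ≤ 1 := max_le hn ((min_le_left _ _).trans h1)
    refine mul_le_mul_of_nonpos_right ?_ (Real.log_nonpos ha.le this)
    exact le_max_of_le_right (le_min le_rfl (h1.trans hn1))

theorem tendsto_truncate {x : ℝ} (hx : 0 ≤ x) :
    Tendsto (fun n => truncate n x) atTop (𝓝 x) := by
  have h1 : Tendsto (fun n : ℕ => 1 / ((n : ℝ) + 1)) atTop (𝓝 0) :=
    tendsto_one_div_add_atTop_nhds_zero_nat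
  have h2 : Tendsto (fun n : ℕ => min x ((n : ℝ) + 1)) atTop (𝓝 x) := by
    refine tendsto_const_nhds.congr' ?_
    filter_upwards [eventually_ge_atTop ⌈x⌉₊] with n hn
    have : x ≤ n := Nat.ceil_le.1 hn
    rw [min_eq_left (by linarith)]
  have := h1.max h2
  rwa [max_eq_right hx] at this

theorem tendsto_slope_truncate (σ : ℝ≥0) :
    Tendsto (fun n => ENNReal.ofReal (σ * Real.log (truncate n σ) - truncate n σ + 1)) atTop
      (𝓝 (F σ)) := by
  refine ENNReal.tendsto_ofReal ?_
  have ht := tendsto_truncate σ.coe_nonneg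
  refine (Tendsto.sub ?_ ht).add_const 1
  rcases eq_or_ne σ 0 with rfl | hσ
  · simp
  · exact (ht.log (by simpa using hσ)).const_mul _

theorem entropy_eq_of_ac {Z : Type*} [MeasurableSpace Z] {γ μ : Measure Z} (h : γ ≪ μ) :
    entropy γ μ = ∫⁻ z, F (γ.rnDeriv μ z).toNNReal ∂μ := by
  simp [entropy, Measure.singularPart_eq_zero_of_ac h]

theorem withDensity_rnDeriv_toNNReal {Z : Type*} [MeasurableSpace Z] {γ μ : Measure Z}
    [IsFiniteMeasure γ] [IsFiniteMeasure μ] (h : γ ≪ μ) :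
    μ.withDensity (fun z => ((γ.rnDeriv μ z).toNNReal : ℝ≥0∞)) = γ := by
  conv_rhs => rw [← Measure.withDensity_rnDeriv_eq γ μ h]
  refine withDensity_congr_ae ?_
  filter_upwards [Measure.rnDeriv_lt_top γ μ] with z hz
  exact ENNReal.coe_toNNReal hz.ne

/-- Jensen's inequality for the entropy of push-forwards: if `π_#(s η) ≤ μ`, the entropy of
`π_#(t η)` relative to `μ` is at most the integrated perspective function plus the mass of `μ`
that is not covered. -/
theorem entropy_map_le {E Z : Type*} [MeasurableSpace E] [MeasurableSpace Z] (η : Measure E)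
    (μ : Measure Z) [IsFiniteMeasure μ] {π : E → Z} (hπ : Measurable π) {s t : E → ℝ≥0}
    (hs : Measurable s) (ht : Measurable t)
    (hle : (η.withDensity fun e => (s e : ℝ≥0∞)).map π ≤ μ)
    (hfin : ∫⁻ e, (t e : ℝ≥0∞) ∂η ≠ ⊤) :
    entropy ((η.withDensity fun e => (t e : ℝ≥0∞)).map π) μ
      ≤ ∫⁻ e, persp (s e) (t e) ∂η
        + (μ - (η.withDensity fun e => (s e : ℝ≥0∞)).map π) Set.univ := by
  rcases eq_or_ne (∫⁻ e, persp (s e) (t e) ∂η) ⊤ with htop | htop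
  · simp [htop]
  have hst : ∀ᵐ e ∂η, s e = 0 → t e = 0 := by
    filter_upwards [ae_lt_top (hs.regUOT_persp ht) htop] with e he hse
    by_contra hte
    rw [hse, persp_zero_left hte] at he
    exact he.ne rfl
  set γ := (η.withDensity fun e => (t e : ℝ≥0∞)).map π with hγ
  have : IsFiniteMeasure (η.withDensity fun e => (t e : ℝ≥0∞)) :=
    isFiniteMeasure_withDensity hfin
  have hac : γ ≪ μ := by
    refine Measure.AbsolutelyContinuous.trans ?_ (Measure.absolutelyContinuous_of_le hle)
    refine Measure.AbsolutelyContinuous.map ?_ hπ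
    refine Measure.AbsolutelyContinuous.mk fun A hA h0 => ?_
    rw [withDensity_apply _ hA, lintegral_eq_zero_iff hs.coe_nnreal_ennreal] at h0
    rw [withDensity_apply _ hA, lintegral_eq_zero_iff ht.coe_nnreal_ennreal]
    filter_upwards [h0, ae_restrict_of_ae hst] with e h1 h2
    have h3 : s e = 0 := by simpa using h1
    simpa using h2 h3
  rw [entropy_eq_of_ac hac]
  set σ : Z → ℝ≥0 := fun z => (γ.rnDeriv μ z).toNNReal
  have hσ : Measurable σ := (Measure.measurable_rnDeriv γ μ).ennreal_toNNReal
  have htr : ∀ n, Measurable (truncate n) := fun n => by unfold truncate; fun_prop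
  have ham : ∀ n, Measurable fun z => truncate n (σ z) := fun n =>
    (htr n).comp hσ.coe_nnreal_real
  have hfatou := lintegral_liminf_le (μ := μ) (u := atTop)
    (f := fun n z => ENNReal.ofReal (σ z * Real.log (truncate n (σ z)) - truncate n (σ z) + 1))
    (fun n => (((hσ.coe_nnreal_real.mul (Real.measurable_log.comp (ham n))).sub
      (ham n)).add_const 1).ennreal_ofReal)
  calc ∫⁻ z, F (σ z) ∂μ
      = ∫⁻ z, liminf (fun n => ENNReal.ofReal
          (σ z * Real.log (truncate n (σ z)) - truncate n (σ z) + 1)) atTop ∂μ :=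
        lintegral_congr fun z => (tendsto_slope_truncate (σ z)).liminf_eq.symm
    _ ≤ _ := hfatou
    _ ≤ liminf (fun _ : ℕ => ∫⁻ e, persp (s e) (t e) ∂η
        + (μ - (η.withDensity fun e => (s e : ℝ≥0∞)).map π) Set.univ) atTop := by
        refine liminf_le_liminf (Eventually.of_forall fun n => ?_)
        refine lintegral_slope_le η μ hπ hs ht hle hfin hσ
          (withDensity_rnDeriv_toNNReal hac).symm (ham n)
          (δ := 1 / ((n : ℝ) + 1)) (K := n + 1) (by positivity) (fun z => le_max_left _ _)
          (fun z => max_le ?_ (min_le_right _ _)) (fun z => slope_truncate_nonneg n (σ z))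
        have : (0 : ℝ) ≤ n := Nat.cast_nonneg n
        rw [div_le_iff₀ (by positivity)]
        nlinarith
    _ = _ := by simp

/-! ### Entropy as an integral of the reverse entropy -/

/-- The density of the part of `μ` that is carried by `γ`, with respect to `γ`: the inverse of
the density of `γ` with respect to `μ`. -/
def invDensity {Z : Type*} [MeasurableSpace Z] (γ μ : Measure Z) (z : Z) : ℝ≥0 :=
  ((γ.rnDeriv μ z).toNNReal)⁻¹

/-- The part of `μ` on which the density of `γ` vanishes. -/
def uncovered {Z : Type*} [MeasurableSpace Z] (γ μ : Measure Z) : Measure Z :=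
  μ.restrict {z | (γ.rnDeriv μ z).toNNReal = 0}

theorem measurable_invDensity {Z : Type*} [MeasurableSpace Z] (γ μ : Measure Z) :
    Measurable (invDensity γ μ) :=
  (Measure.measurable_rnDeriv γ μ).ennreal_toNNReal.inv

theorem withDensity_invDensity_add_uncovered {Z : Type*} [MeasurableSpace Z] {γ μ : Measure Z}
    [IsFiniteMeasure γ] [IsFiniteMeasure μ] (h : γ ≪ μ) :
    γ.withDensity (fun z => (invDensity γ μ z : ℝ≥0∞)) + uncovered γ μ = μ := by
  have hσ : Measurable fun z => (γ.rnDeriv μ z).toNNReal :=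
    (Measure.measurable_rnDeriv γ μ).ennreal_toNNReal
  have hA : MeasurableSet {z | (γ.rnDeriv μ z).toNNReal = 0} := hσ (measurableSet_singleton 0)
  conv_lhs => enter [1, 1]; rw [← withDensity_rnDeriv_toNNReal h]
  rw [← withDensity_mul _ hσ.coe_nnreal_ennreal (measurable_invDensity γ μ).coe_nnreal_ennreal]
  conv_rhs => rw [← Measure.restrict_compl_add_restrict hA (μ := μ)]
  rw [uncovered]
  congr 1
  have : ((fun z => ((γ.rnDeriv μ z).toNNReal : ℝ≥0∞)) * fun z => (invDensity γ μ z : ℝ≥0∞))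
      = {z | (γ.rnDeriv μ z).toNNReal = 0}ᶜ.indicator 1 := by
    ext z
    by_cases hz : (γ.rnDeriv μ z).toNNReal = 0
    · simp [hz]
    · simp only [Pi.mul_apply, invDensity, ← ENNReal.coe_mul, mul_inv_cancel₀ hz]
      simp only [Set.indicator, Set.mem_compl_iff, Set.mem_ofPred_eq, hz, not_false_eq_true,
        if_true, Pi.one_apply, ENNReal.coe_one]
  rw [this, withDensity_indicator_one hA.compl]

theorem lintegral_R_invDensity_add_uncovered {Z : Type*} [MeasurableSpace Z] {γ μ : Measure Z}
    [IsFiniteMeasure γ] [IsFiniteMeasure μ] (h : γ ≪ μ) :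
    ∫⁻ z, R (invDensity γ μ z) ∂γ + uncovered γ μ Set.univ = entropy γ μ := by
  have hσ : Measurable fun z => (γ.rnDeriv μ z).toNNReal :=
    (Measure.measurable_rnDeriv γ μ).ennreal_toNNReal
  have hA : MeasurableSet {z | (γ.rnDeriv μ z).toNNReal = 0} := hσ (measurableSet_singleton 0)
  have hR : Measurable fun z => R (invDensity γ μ z) :=
    measurable_R.comp (measurable_invDensity γ μ)
  have hσR : Measurable fun z => ((γ.rnDeriv μ z).toNNReal : ℝ≥0∞) * R (invDensity γ μ z) :=
    hσ.coe_nnreal_ennreal.mul hR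
  have e1 : ∫⁻ z, R (invDensity γ μ z) ∂γ
      = ∫⁻ z, (γ.rnDeriv μ z).toNNReal * R (invDensity γ μ z) ∂μ := by
    conv_lhs => enter [1]; rw [← withDensity_rnDeriv_toNNReal h]
    rw [lintegral_withDensity_coe μ hσ hR]
  rw [entropy_eq_of_ac h, e1, uncovered, Measure.restrict_apply_univ,
    ← lintegral_indicator_one hA, ← lintegral_add_left hσR]
  refine lintegral_congr fun z => ?_
  by_cases hz : (γ.rnDeriv μ z).toNNReal = 0
  · simp [hz, F_zero]
  · have hz' : z ∉ {z | (γ.rnDeriv μ z).toNNReal = 0} := hz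
    rw [Set.indicator_of_notMem hz', add_zero, R, invDensity, if_neg (inv_ne_zero hz), one_div,
      inv_inv, ← mul_assoc, ← ENNReal.coe_mul, mul_inv_cancel₀ hz, ENNReal.coe_one, one_mul]

theorem absolutelyContinuous_of_entropy_ne_top {Z : Type*} [MeasurableSpace Z]
    {γ μ : Measure Z} [IsFiniteMeasure γ] [IsFiniteMeasure μ] (h : entropy γ μ ≠ ⊤) : γ ≪ μ := by
  rw [← Measure.singularPart_eq_zero, ← Measure.measure_univ_eq_zero]
  by_contra h0
  exact h (by simp [entropy, FInfty, ENNReal.top_mul h0])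

/-! ### The shifted cost -/

/-- A cost bounded below is a nonnegative cost minus a constant. -/
theorem exists_shifted_cost {Z : Type*} [MeasurableSpace Z] {c : Z → EReal} (hc : Measurable c)
    (hcb : ∃ m : ℝ, ∀ x, (m : EReal) ≤ c x) :
    ∃ (M : ℝ≥0) (k : Z → ℝ≥0∞), Measurable k ∧
      ∀ x, c x = (k x : EReal) - ((M : ℝ) : EReal) := by
  obtain ⟨m, hm⟩ := hcb
  refine ⟨Real.toNNReal (-m), fun x => (c x + ((Real.toNNReal (-m) : ℝ) : EReal)).toENNReal,
    (hc.add_const _).ereal_toENNReal, fun x => ?_⟩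
  rw [EReal.coe_toENNReal, EReal.add_sub_cancel_right]
  calc (0 : EReal) ≤ ((m + (Real.toNNReal (-m) : ℝ) : ℝ) : EReal) := by
        have := Real.le_coe_toNNReal (-m)
        exact_mod_cast (by linarith : 0 ≤ m + (Real.toNNReal (-m) : ℝ))
    _ = (m : EReal) + ((Real.toNNReal (-m) : ℝ) : EReal) := EReal.coe_add _ _
    _ ≤ _ := add_le_add_left (hm x) _

theorem eintegral_shifted_cost {Z : Type*} [MeasurableSpace Z] {c : Z → EReal} {k : Z → ℝ≥0∞}
    {M : ℝ≥0} (hk : Measurable k) (hck : ∀ x, c x = (k x : EReal) - ((M : ℝ) : EReal))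
    (γ : Measure Z) [IsFiniteMeasure γ] :
    eintegral γ c = ((∫⁻ x, k x ∂γ : ℝ≥0∞) : EReal) - ((M * γ Set.univ : ℝ≥0∞) : EReal) := by
  have h := eintegral_coe_sub γ hk (measurable_const (a := (M : ℝ≥0∞)))
    (fun _ => ENNReal.coe_ne_top)
    (by rw [lintegral_const]; exact ENNReal.mul_ne_top ENNReal.coe_ne_top (measure_ne_top _ _))
  rw [lintegral_const] at h
  rw [← h]
  exact congrArg _ (funext hck)

theorem primal_eq {X : Type*} [MeasurableSpace X] {c : X × X → EReal} {k : X × X → ℝ≥0∞}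
    {M : ℝ≥0} (hk : Measurable k) (hck : ∀ x, c x = (k x : EReal) - ((M : ℝ) : EReal)) (ε : ℝ)
    (μ₀ μ₁ : Measure X) (ν γ : Measure (X × X)) [IsFiniteMeasure γ] :
    primal c ε μ₀ μ₁ ν γ
      = ((entropy (γ.map Prod.fst) μ₀ + entropy (γ.map Prod.snd) μ₁ + ∫⁻ x, k x ∂γ
          + ENNReal.ofReal ε * entropy γ ν : ℝ≥0∞) : EReal)
        - ((M * γ Set.univ : ℝ≥0∞) : EReal) := by
  rw [primal, eintegral_shifted_cost hk hck]
  simp only [EReal.coe_ennreal_add, sub_eq_add_neg]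
  generalize -((M * γ Set.univ : ℝ≥0∞) : EReal) = n
  abel

/-! ### The cost on the extended space -/

section Extended

variable {X : Type*}

/-- The objective at a point of the extended space. -/
def extObjective (ε p : ℝ) (k : X × X → ℝ≥0∞) (z : Ext X) (t : ℝ≥0) : ℝ≥0∞ :=
  objective ε (k (z.1.1, z.2.1.1)) (z.1.2 ^ p) (z.2.1.2 ^ p) (z.2.2 ^ p) t

/-- The minimiser of the objective at a point of the extended space. -/
def extTime (ε p : ℝ) (M : ℝ≥0) (k : X × X → ℝ≥0∞) (z : Ext X) : ℝ≥0 :=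
  optTime ε M (k (z.1.1, z.2.1.1)) (z.1.2 ^ p) (z.2.1.2 ^ p) (z.2.2 ^ p)

variable [MeasurableSpace X] {k : X × X → ℝ≥0∞} {ε : ℝ} (p : ℝ) (M : ℝ≥0)

theorem measurable_extTime (hk : Measurable k) : Measurable (extTime ε p M k) := by
  unfold extTime optTime
  have hk' : Measurable fun z : Ext X => k (z.1.1, z.2.1.1) := hk.comp (by fun_prop)
  have h0 : Measurable fun z : Ext X => z.1.2 ^ p := by fun_prop
  have h1 : Measurable fun z : Ext X => z.2.1.2 ^ p := by fun_prop
  have h2 : Measurable fun z : Ext X => z.2.2 ^ p := by fun_prop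
  refine Measurable.ite ?_ measurable_const ?_
  · exact (h0 (measurableSet_singleton 0)).union ((h1 (measurableSet_singleton 0)).union
      ((h2 (measurableSet_singleton 0)).union (hk' (measurableSet_singleton ⊤))))
  · have h0' := h0.coe_nnreal_real
    have h1' := h1.coe_nnreal_real
    have h2' := h2.coe_nnreal_real
    have hk'' := hk'.ennreal_toReal
    fun_prop

theorem measurable_extObjective (hk : Measurable k) {t : Ext X → ℝ≥0} (ht : Measurable t) :
    Measurable fun z => extObjective ε p k z (t z) := by
  unfold extObjective objective
  have hk' : Measurable fun z : Ext X => k (z.1.1, z.2.1.1) := hk.comp (by fun_prop)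
  have h0 := Measurable.regUOT_persp (s := fun z : Ext X => z.1.2 ^ p) (by fun_prop) ht
  have h1 := Measurable.regUOT_persp (s := fun z : Ext X => z.2.1.2 ^ p) (by fun_prop) ht
  have h2 := Measurable.regUOT_persp (s := fun z : Ext X => z.2.2 ^ p) (by fun_prop) ht
  exact ((h0.add h1).add (h2.const_mul _)).add (ht.coe_nnreal_ennreal.mul hk')

theorem eintegral_H {c : X × X → EReal} (hε : 0 < ε) (hk : Measurable k) {M : ℝ≥0}
    (hck : ∀ x, c x = (k x : EReal) - ((M : ℝ) : EReal)) (η : Measure (Ext X))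
    (hη : ∫⁻ z, (extTime ε p M k z : ℝ≥0∞) ∂η ≠ ⊤) :
    eintegral η (H c ε p)
      = ((∫⁻ z, extObjective ε p k z (extTime ε p M k z) ∂η : ℝ≥0∞) : EReal)
        - ((M * ∫⁻ z, (extTime ε p M k z : ℝ≥0∞) ∂η : ℝ≥0∞) : EReal) := by
  have ht := measurable_extTime (ε := ε) p M hk
  rw [← lintegral_const_mul _ ht.coe_nnreal_ennreal]
  rw [← eintegral_coe_sub η (measurable_extObjective p hk ht)
    (ht.coe_nnreal_ennreal.const_mul _)
    (fun _ => ENNReal.mul_ne_top ENNReal.coe_ne_top ENNReal.coe_ne_top)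
    (by
      rw [lintegral_const_mul _ ht.coe_nnreal_ennreal]
      exact ENNReal.mul_ne_top ENNReal.coe_ne_top hη)]
  congr 1
  funext z
  rw [H, hck, pointCost_eq hε, ENNReal.coe_mul]
  rfl

theorem lintegral_extTime_ne_top (hε : 0 < ε) {μ₀ μ₁ : Measure X} {ν : Measure (X × X)}
    [IsFiniteMeasure μ₀] [IsFiniteMeasure μ₁] [IsFiniteMeasure ν] {η : Measure (Ext X)}
    (hη : η ∈ SLe p μ₀ μ₁ ν) : ∫⁻ z, (extTime ε p M k z : ℝ≥0∞) ∂η ≠ ⊤ := by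
  obtain ⟨-, h0, h1, h2⟩ := hη
  have m0 : Measurable fun z : Ext X => ((z.1.2 ^ p : ℝ≥0) : ℝ≥0∞) := by fun_prop
  have m1 : Measurable fun z : Ext X => ((z.2.1.2 ^ p : ℝ≥0) : ℝ≥0∞) := by fun_prop
  have m2 : Measurable fun z : Ext X => ((z.2.2 ^ p : ℝ≥0) : ℝ≥0∞) := by fun_prop
  have mass : ∀ {Z : Type _} [MeasurableSpace Z] (ξ : Measure Z) [IsFiniteMeasure ξ]
      (w : Ext X → ℝ≥0∞) (π : Ext X → Z), Measurable π → (η.withDensity w).map π ≤ ξ →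
      ∫⁻ z, w z ∂η ≠ ⊤ := fun ξ _ w π hπ hle => by
    have h := hle Set.univ
    rw [Measure.map_apply hπ MeasurableSet.univ, Set.preimage_univ,
      withDensity_apply _ MeasurableSet.univ, Measure.restrict_univ] at h
    exact ne_top_of_le_ne_top (measure_ne_top _ _) h
  have i0 := mass μ₀ _ _ (by fun_prop) h0
  have i1 := mass μ₁ _ _ (by fun_prop) h1
  have i2 := mass ν _ _ (by fun_prop) h2
  refine ne_top_of_le_ne_top ?_ (lintegral_mono fun z => optTime_le hε M _ _ _ _)
  rw [lintegral_add_right _ (m2.const_mul _), lintegral_add_right _ m1,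
    lintegral_mul_const _ m0, lintegral_const_mul _ m2]
  exact ENNReal.add_ne_top.2 ⟨ENNReal.add_ne_top.2
    ⟨ENNReal.mul_ne_top i0 ENNReal.ofReal_ne_top, i1⟩,
    ENNReal.mul_ne_top ENNReal.ofReal_ne_top i2⟩

/-! ### From extended plans to plans -/

/-- Projecting the extended plan reweighted by the optimal time gives a competitor for the
original problem whose primal value is no larger. -/
theorem UOT_le_eintegral_add_defect {c : X × X → EReal} (hε : 0 < ε) (hk : Measurable k)
    {M : ℝ≥0} (hck : ∀ x, c x = (k x : EReal) - ((M : ℝ) : EReal)) {μ₀ μ₁ : Measure X}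
    {ν : Measure (X × X)} [IsFiniteMeasure μ₀] [IsFiniteMeasure μ₁] [IsFiniteMeasure ν]
    {η : Measure (Ext X)} (hη : η ∈ SLe p μ₀ μ₁ ν) :
    UOT c ε μ₀ μ₁ ν
      ≤ eintegral η (H c ε p) + (defect (ENNReal.ofReal ε) p μ₀ μ₁ ν η : EReal) := by
  have ht := measurable_extTime (ε := ε) p M hk
  have htop := lintegral_extTime_ne_top (k := k) p M hε hη
  obtain ⟨-, hη0, hη1, hη2⟩ := hη
  set t := extTime ε p M k
  have : IsFiniteMeasure (η.withDensity fun z => (t z : ℝ≥0∞)) := isFiniteMeasure_withDensity htop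
  have hπ : Measurable fun z : Ext X => (z.1.1, z.2.1.1) := by fun_prop
  set γ := (η.withDensity fun z => (t z : ℝ≥0∞)).map fun z => (z.1.1, z.2.1.1) with hγ
  have hs0 : Measurable fun z : Ext X => z.1.2 ^ p := by fun_prop
  have hs1 : Measurable fun z : Ext X => z.2.1.2 ^ p := by fun_prop
  have hs2 : Measurable fun z : Ext X => z.2.2 ^ p := by fun_prop
  have e0 := entropy_map_le η μ₀ (π := fun z => z.1.1) (by fun_prop) hs0 ht hη0 htop
  have e1 := entropy_map_le η μ₁ (π := fun z => z.2.1.1) (by fun_prop) hs1 ht hη1 htop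
  have e2 := entropy_map_le η ν hπ hs2 ht hη2 htop
  have g0 : γ.map Prod.fst = (η.withDensity fun z => (t z : ℝ≥0∞)).map fun z => z.1.1 :=
    Measure.map_map measurable_fst hπ
  have g1 : γ.map Prod.snd = (η.withDensity fun z => (t z : ℝ≥0∞)).map fun z => z.2.1.1 :=
    Measure.map_map measurable_snd hπ
  have gk : ∫⁻ x, k x ∂γ = ∫⁻ z, t z * k (z.1.1, z.2.1.1) ∂η :=
    lintegral_map_withDensity_coe η hπ ht hk
  have gu : γ Set.univ = ∫⁻ z, (t z : ℝ≥0∞) ∂η := by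
    rw [hγ, Measure.map_apply hπ MeasurableSet.univ, Set.preimage_univ,
      withDensity_apply _ MeasurableSet.univ, Measure.restrict_univ]
  have hobj : ∫⁻ z, extObjective ε p k z (t z) ∂η
      = ∫⁻ z, persp (z.1.2 ^ p) (t z) ∂η + ∫⁻ z, persp (z.2.1.2 ^ p) (t z) ∂η
        + ENNReal.ofReal ε * ∫⁻ z, persp (z.2.2 ^ p) (t z) ∂η
        + ∫⁻ z, t z * k (z.1.1, z.2.1.1) ∂η := by
    have p1 := hs1.regUOT_persp ht
    have p2 := hs2.regUOT_persp ht
    have p3 : Measurable fun z : Ext X => (t z : ℝ≥0∞) * k (z.1.1, z.2.1.1) :=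
      ht.coe_nnreal_ennreal.mul (hk.comp hπ)
    simp only [extObjective, objective]
    rw [lintegral_add_right _ p3, lintegral_add_right _ (p2.const_mul _),
      lintegral_add_right _ p1, lintegral_const_mul _ p2]
  refine (iInf₂_le γ (show IsFiniteMeasure γ from inferInstance)).trans ?_
  rw [primal_eq hk hck, eintegral_H p hε hk hck η htop, hobj, g0, g1, gk, gu]
  refine coe_sub_le_coe_sub_add _ ?_
  rw [defect, F_zero, one_mul]
  refine (add_le_add (add_le_add_left (add_le_add e0 e1) _)
    (mul_le_mul_right e2 (ENNReal.ofReal ε))).trans_eq ?_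
  rw [h₀, h₁, hJoint]
  ring

/-! ### From plans to extended plans -/

/-- A homogeneous marginal of a push-forward, when the weight depends only on the projected
point. -/
theorem map_withDensity_map {A B Z : Type*} [MeasurableSpace A] [MeasurableSpace B]
    [MeasurableSpace Z] (γ : Measure A) {T : A → B} (hT : Measurable T) {π : B → Z}
    (hπ : Measurable π) {w : B → ℝ≥0} (hw : Measurable w) {r : Z → ℝ≥0} (hr : Measurable r)
    {q : A → Z} (hπq : ∀ a, π (T a) = q a) (hwr : ∀ a, w (T a) = r (q a)) :
    (((γ.map T).withDensity fun b => (w b : ℝ≥0∞)).map π)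
      = (γ.map q).withDensity fun z => (r z : ℝ≥0∞) := by
  have hq : Measurable q := (funext hπq : π ∘ T = q) ▸ hπ.comp hT
  refine Measure.ext_of_lintegral _ fun f hf => ?_
  have hwf : Measurable fun b => (w b : ℝ≥0∞) * f (π b) :=
    hw.coe_nnreal_ennreal.mul (hf.comp hπ)
  have hrf : Measurable fun z => (r z : ℝ≥0∞) * f z := hr.coe_nnreal_ennreal.mul hf
  rw [lintegral_map_withDensity_coe _ hπ hw hf, lintegral_withDensity_coe _ hr hf,
    lintegral_map hwf hT, lintegral_map hrf hq]
  refine lintegral_congr fun a => ?_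
  rw [hwr, hπq]

theorem h₀_add (η θ : Measure (Ext X)) : h₀ p (η + θ) = h₀ p η + h₀ p θ := by
  rw [h₀, withDensity_add_measure, Measure.map_add _ _ (by fun_prop)]; rfl

theorem h₁_add (η θ : Measure (Ext X)) : h₁ p (η + θ) = h₁ p η + h₁ p θ := by
  rw [h₁, withDensity_add_measure, Measure.map_add _ _ (by fun_prop)]; rfl

theorem hJoint_add (η θ : Measure (Ext X)) : hJoint p (η + θ) = hJoint p η + hJoint p θ := by
  rw [hJoint, withDensity_add_measure, Measure.map_add _ _ (by fun_prop)]; rfl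

/-- The lift of a plan `γ`: the radial coordinates are the `p`-th roots of the inverse densities,
and the parts of `μ₀`, `μ₁` and `ν` not seen by `γ` are carried by points at which the other two
radial coordinates vanish. -/
def liftPlan (μ₀ μ₁ : Measure X) (ν γ : Measure (X × X)) : Measure (Ext X) :=
  γ.map (fun x => ((x.1, invDensity (γ.map Prod.fst) μ₀ x.1 ^ (1 / p)),
      (x.2, invDensity (γ.map Prod.snd) μ₁ x.2 ^ (1 / p)), invDensity γ ν x ^ (1 / p)))
    + (uncovered (γ.map Prod.fst) μ₀).map (fun x => ((x, 1), (x, 0), 0))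
    + (uncovered (γ.map Prod.snd) μ₁).map (fun x => ((x, 0), (x, 1), 0))
    + (uncovered γ ν).map (fun x => ((x.1, 0), (x.2, 0), 1))

variable {p}

theorem rpow_one_div_rpow (hp : 0 < p) (a : ℝ≥0) : (a ^ (1 / p)) ^ p = a := by
  rw [← NNReal.rpow_mul, one_div_mul_cancel hp.ne', NNReal.rpow_one]

theorem measurable_liftPlan_main (μ₀ μ₁ : Measure X) (ν γ : Measure (X × X)) :
    Measurable fun x : X × X => (((x.1, invDensity (γ.map Prod.fst) μ₀ x.1 ^ (1 / p)),
      (x.2, invDensity (γ.map Prod.snd) μ₁ x.2 ^ (1 / p)),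
      invDensity γ ν x ^ (1 / p)) : Ext X) := by
  have a0 := measurable_invDensity (γ.map Prod.fst) μ₀
  have a1 := measurable_invDensity (γ.map Prod.snd) μ₁
  have a2 := measurable_invDensity γ ν
  fun_prop

theorem liftPlan_mem_SEq (hp : 0 < p) {μ₀ μ₁ : Measure X} {ν γ : Measure (X × X)}
    [IsFiniteMeasure μ₀] [IsFiniteMeasure μ₁] [IsFiniteMeasure ν] [IsFiniteMeasure γ]
    (h0 : γ.map Prod.fst ≪ μ₀) (h1 : γ.map Prod.snd ≪ μ₁) (h2 : γ ≪ ν) :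
    liftPlan p μ₀ μ₁ ν γ ∈ SEq p μ₀ μ₁ ν := by
  have hT := measurable_liftPlan_main (p := p) μ₀ μ₁ ν γ
  have a0 := measurable_invDensity (γ.map Prod.fst) μ₀
  have a1 := measurable_invDensity (γ.map Prod.snd) μ₁
  have a2 := measurable_invDensity γ ν
  have hz : (0 : ℝ≥0) ^ p = 0 := NNReal.zero_rpow hp.ne'
  have : IsFiniteMeasure (uncovered (γ.map Prod.fst) μ₀) := by unfold uncovered; infer_instance
  have : IsFiniteMeasure (uncovered (γ.map Prod.snd) μ₁) := by unfold uncovered; infer_instance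
  have : IsFiniteMeasure (uncovered γ ν) := by unfold uncovered; infer_instance
  have m0 : Measurable fun x : X => (((x, 1), (x, 0), 0) : Ext X) := by fun_prop
  have m1 : Measurable fun x : X => (((x, 0), (x, 1), 0) : Ext X) := by fun_prop
  have m2 : Measurable fun x : X × X => (((x.1, 0), (x.2, 0), 1) : Ext X) := by fun_prop
  refine ⟨by unfold liftPlan; infer_instance, ?_, ?_, ?_⟩
  · rw [liftPlan, h₀_add, h₀_add, h₀_add, h₀, h₀, h₀, h₀]
    rw [map_withDensity_map (w := fun z : Ext X => z.1.2 ^ p) γ hT (by fun_prop) (by fun_prop)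
        a0 (q := Prod.fst) (fun _ => rfl) (fun _ => rpow_one_div_rpow hp _),
      map_withDensity_map (w := fun z : Ext X => z.1.2 ^ p) _ m0 (by fun_prop)
        (by fun_prop) (r := fun _ => 1) measurable_const (q := id) (fun _ => rfl)
        (fun _ => NNReal.one_rpow p),
      map_withDensity_map (w := fun z : Ext X => z.1.2 ^ p) _ m1 (by fun_prop)
        (by fun_prop) (r := fun _ => 0) measurable_const (q := id) (fun _ => rfl) (fun _ => hz),
      map_withDensity_map (w := fun z : Ext X => z.1.2 ^ p) _ m2 (by fun_prop)
        (by fun_prop) (r := fun _ => 0) measurable_const (q := Prod.fst) (fun _ => rfl)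
        (fun _ => hz)]
    simpa using withDensity_invDensity_add_uncovered h0
  · rw [liftPlan, h₁_add, h₁_add, h₁_add, h₁, h₁, h₁, h₁]
    rw [map_withDensity_map (w := fun z : Ext X => z.2.1.2 ^ p) γ hT (by fun_prop) (by fun_prop)
        a1 (q := Prod.snd) (fun _ => rfl) (fun _ => rpow_one_div_rpow hp _),
      map_withDensity_map (w := fun z : Ext X => z.2.1.2 ^ p) _ m0 (by fun_prop)
        (by fun_prop) (r := fun _ => 0) measurable_const (q := id) (fun _ => rfl) (fun _ => hz),
      map_withDensity_map (w := fun z : Ext X => z.2.1.2 ^ p) _ m1 (by fun_prop)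
        (by fun_prop) (r := fun _ => 1) measurable_const (q := id) (fun _ => rfl)
        (fun _ => NNReal.one_rpow p),
      map_withDensity_map (w := fun z : Ext X => z.2.1.2 ^ p) _ m2 (by fun_prop)
        (by fun_prop) (r := fun _ => 0) measurable_const (q := Prod.snd) (fun _ => rfl)
        (fun _ => hz)]
    simpa using withDensity_invDensity_add_uncovered h1
  · rw [liftPlan, hJoint_add, hJoint_add, hJoint_add, hJoint, hJoint, hJoint, hJoint]
    rw [map_withDensity_map (w := fun z : Ext X => z.2.2 ^ p) γ hT (by fun_prop) (by fun_prop)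
        a2 (q := id) (fun _ => rfl) (fun _ => rpow_one_div_rpow hp _),
      map_withDensity_map (w := fun z : Ext X => z.2.2 ^ p) _ m0 (by fun_prop)
        (by fun_prop) (r := fun _ => 0) measurable_const (q := fun x => (x, x)) (fun _ => rfl)
        (fun _ => hz),
      map_withDensity_map (w := fun z : Ext X => z.2.2 ^ p) _ m1 (by fun_prop)
        (by fun_prop) (r := fun _ => 0) measurable_const (q := fun x => (x, x)) (fun _ => rfl)
        (fun _ => hz),
      map_withDensity_map (w := fun z : Ext X => z.2.2 ^ p) _ m2 (by fun_prop)
        (by fun_prop) (r := fun _ => 1) measurable_const (q := id) (fun _ => rfl)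
        (fun _ => NNReal.one_rpow p)]
    simpa using withDensity_invDensity_add_uncovered h2

theorem SEq_subset_SLe (μ₀ μ₁ : Measure X) (ν : Measure (X × X)) :
    SEq p μ₀ μ₁ ν ⊆ SLe p μ₀ μ₁ ν :=
  fun _ h => ⟨h.1, h.2.1.le, h.2.2.1.le, h.2.2.2.le⟩

/-- Testing the lifted plan with `t = 1` on the lift of `γ` itself and with `t = 0` on the
remaining pieces bounds its cost by the primal value of `γ`. -/
theorem eintegral_liftPlan_le {c : X × X → EReal} (hε : 0 < ε) (hp : 0 < p) (hk : Measurable k)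
    {M : ℝ≥0} (hck : ∀ x, c x = (k x : EReal) - ((M : ℝ) : EReal)) {μ₀ μ₁ : Measure X}
    {ν γ : Measure (X × X)} [IsFiniteMeasure μ₀] [IsFiniteMeasure μ₁] [IsFiniteMeasure ν]
    [IsFiniteMeasure γ] (h0 : γ.map Prod.fst ≪ μ₀) (h1 : γ.map Prod.snd ≪ μ₁) (h2 : γ ≪ ν) :
    eintegral (liftPlan p μ₀ μ₁ ν γ) (H c ε p) ≤ primal c ε μ₀ μ₁ ν γ := by
  have ht := measurable_extTime (ε := ε) p M hk
  have htop := lintegral_extTime_ne_top (k := k) p M hε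
    (SEq_subset_SLe μ₀ μ₁ ν (liftPlan_mem_SEq hp h0 h1 h2))
  have hG := measurable_extObjective (ε := ε) p hk ht
  have hopt : ∀ z (r : ℝ≥0), extObjective ε p k z (extTime ε p M k z) + (M * r : ℝ≥0)
      ≤ extObjective ε p k z r + (M * extTime ε p M k z : ℝ≥0) :=
    fun z r => objective_optTime_le hε M _ _ _ _ r
  rw [eintegral_H p hε hk hck _ htop, primal_eq hk hck]
  refine coe_sub_le_coe_sub (ENNReal.mul_ne_top ENNReal.coe_ne_top htop)
    (ENNReal.mul_ne_top ENNReal.coe_ne_top (measure_ne_top _ _)) ?_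
  generalize extTime ε p M k = t at *
  have hMt : Measurable fun z => (M : ℝ≥0∞) * t z := ht.coe_nnreal_ennreal.const_mul _
  have hz : (0 : ℝ≥0) ^ p = 0 := NNReal.zero_rpow hp.ne'
  -- The bound on each piece, integrated from the minimality of `t` against a constant time `r`.
  have piece : ∀ {A : Type _} [MeasurableSpace A] (ξ : Measure A) {T : A → Ext X},
      Measurable T → ∀ r : ℝ≥0, ∫⁻ z, extObjective ε p k z (t z) ∂(ξ.map T)
        + M * r * ξ Set.univ
      ≤ ∫⁻ a, extObjective ε p k (T a) r ∂ξ + ∫⁻ z, M * t z ∂(ξ.map T) := by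
    intro A _ ξ T hT r
    have hMtT : Measurable fun a => (M : ℝ≥0∞) * t (T a) := hMt.comp hT
    rw [lintegral_map hG hT, lintegral_map hMt hT, ← lintegral_const,
      ← lintegral_add_right _ measurable_const, ← lintegral_add_right _ hMtT]
    refine lintegral_mono fun a => ?_
    have := hopt (T a) r
    push_cast at this
    exact this
  have m0 : Measurable fun x : X => (((x, 1), (x, 0), 0) : Ext X) := by fun_prop
  have m1 : Measurable fun x : X => (((x, 0), (x, 1), 0) : Ext X) := by fun_prop
  have m2 : Measurable fun x : X × X => (((x.1, 0), (x.2, 0), 1) : Ext X) := by fun_prop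
  have b := piece γ (measurable_liftPlan_main (p := p) μ₀ μ₁ ν γ) 1
  have b0 := piece (uncovered (γ.map Prod.fst) μ₀) m0 0
  have b1 := piece (uncovered (γ.map Prod.snd) μ₁) m1 0
  have b2 := piece (uncovered γ ν) m2 0
  simp only [extObjective, objective_zero, hz, NNReal.one_rpow, ENNReal.coe_zero,
    ENNReal.coe_one, mul_zero, mul_one, zero_mul, add_zero, zero_add, lintegral_const, one_mul]
    at b0 b1 b2
  have R0 : Measurable fun x => R (invDensity (γ.map Prod.fst) μ₀ x) :=
    measurable_R.comp (measurable_invDensity _ _)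
  have R1 : Measurable fun x => R (invDensity (γ.map Prod.snd) μ₁ x) :=
    measurable_R.comp (measurable_invDensity _ _)
  have R2 : Measurable fun x => R (invDensity γ ν x) :=
    measurable_R.comp (measurable_invDensity _ _)
  have R1s : Measurable fun x : X × X => R (invDensity (γ.map Prod.snd) μ₁ x.2) :=
    R1.comp measurable_snd
  have hb : ∫⁻ x : X × X, extObjective ε p k
        ((x.1, invDensity (γ.map Prod.fst) μ₀ x.1 ^ (1 / p)),
          (x.2, invDensity (γ.map Prod.snd) μ₁ x.2 ^ (1 / p)), invDensity γ ν x ^ (1 / p)) 1 ∂γ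
      = ∫⁻ x, R (invDensity (γ.map Prod.fst) μ₀ x) ∂(γ.map Prod.fst)
        + ∫⁻ x, R (invDensity (γ.map Prod.snd) μ₁ x) ∂(γ.map Prod.snd)
        + ENNReal.ofReal ε * ∫⁻ x, R (invDensity γ ν x) ∂γ + ∫⁻ x, k x ∂γ := by
    simp only [extObjective, objective, rpow_one_div_rpow hp, persp_one_right, ENNReal.coe_one,
      one_mul, Prod.mk.eta]
    rw [lintegral_add_right _ hk, lintegral_add_right _ (R2.const_mul _),
      lintegral_add_right _ R1s, lintegral_const_mul _ R2,
      lintegral_map R0 measurable_fst, lintegral_map R1 measurable_snd]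
  rw [hb] at b
  rw [← lintegral_R_invDensity_add_uncovered h0, ← lintegral_R_invDensity_add_uncovered h1,
    ← lintegral_R_invDensity_add_uncovered h2, ← lintegral_const_mul _ ht.coe_nnreal_ennreal,
    liftPlan]
  simp only [lintegral_add_measure]
  rw [ENNReal.coe_one, mul_one] at b
  refine le_trans (le_of_eq ?_) ((add_le_add (add_le_add (add_le_add b b0) b1) b2).trans_eq ?_)
  · simp only [extObjective]
    ring
  · ring

theorem iInf_SEq_le_UOT {c : X × X → EReal} (hε : 0 < ε) (hp : 0 < p) (hk : Measurable k)
    {M : ℝ≥0} (hck : ∀ x, c x = (k x : EReal) - ((M : ℝ) : EReal)) {μ₀ μ₁ : Measure X}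
    {ν : Measure (X × X)} [IsFiniteMeasure μ₀] [IsFiniteMeasure μ₁] [IsFiniteMeasure ν] :
    ⨅ η ∈ SEq p μ₀ μ₁ ν, eintegral η (H c ε p) ≤ UOT c ε μ₀ μ₁ ν := by
  refine le_iInf₂ fun γ hγ => ?_
  have : IsFiniteMeasure γ := hγ
  by_cases hfin : entropy (γ.map Prod.fst) μ₀ + entropy (γ.map Prod.snd) μ₁ + ∫⁻ x, k x ∂γ
      + ENNReal.ofReal ε * entropy γ ν = ⊤
  · have hM : (M * γ Set.univ : ℝ≥0∞) ≠ ⊤ :=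
      ENNReal.mul_ne_top ENNReal.coe_ne_top (measure_ne_top _ _)
    rw [primal_eq hk hck, hfin]
    lift (M * γ Set.univ : ℝ≥0∞) to ℝ≥0 using hM with m
    rw [EReal.coe_ennreal_top, EReal.coe_nnreal_eq_coe_real, EReal.top_sub_coe]
    exact le_top
  · simp only [ENNReal.add_eq_top, not_or] at hfin
    obtain ⟨⟨⟨f0, f1⟩, -⟩, f2⟩ := hfin
    have f2' : entropy γ ν ≠ ⊤ := fun h =>
      f2 (by rw [h, ENNReal.mul_top (by simpa using hε)])
    have h0 := absolutelyContinuous_of_entropy_ne_top f0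
    have h1 := absolutelyContinuous_of_entropy_ne_top f1
    have h2 := absolutelyContinuous_of_entropy_ne_top f2'
    exact (iInf₂_le _ (liftPlan_mem_SEq hp h0 h1 h2)).trans
      (eintegral_liftPlan_le hε hp hk hck h0 h1 h2)

/-- Plans with exact homogeneous marginals have no mass defect. -/
theorem iInf_SLe_le_iInf_SEq (κ : ℝ≥0∞) (f : Ext X → EReal) (μ₀ μ₁ : Measure X)
    (ν : Measure (X × X)) [IsFiniteMeasure μ₀] [IsFiniteMeasure μ₁] [IsFiniteMeasure ν] :
    ⨅ η ∈ SLe p μ₀ μ₁ ν, eintegral η f + (defect κ p μ₀ μ₁ ν η : EReal)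
      ≤ ⨅ η ∈ SEq p μ₀ μ₁ ν, eintegral η f := by
  refine le_iInf₂ fun η hη => (iInf₂_le η (SEq_subset_SLe μ₀ μ₁ ν hη)).trans_eq ?_
  obtain ⟨-, h0, h1, h2⟩ := hη
  simp [defect, h0, h1, h2]

end Extended

end RegUOT

end

theorem mainTheorem3 {X : Type*} [MetricSpace X] [CompleteSpace X]
    [SecondCountableTopology X] [MeasurableSpace X] [BorelSpace X]
    (c : X × X → EReal) (hc : LowerSemicontinuous c) (hcb : ∃ m : ℝ, ∀ x, (m : EReal) ≤ c x)
    (ε p : ℝ) (hε : 0 < ε) (hp : 0 < p)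
    (μ₀ μ₁ : Measure X) [IsFiniteMeasure μ₀] [IsFiniteMeasure μ₁]
    (ν : Measure (X × X)) [IsFiniteMeasure ν] :
    (RegUOT.UOT c ε μ₀ μ₁ ν =
        ⨅ η ∈ RegUOT.SLe p μ₀ μ₁ ν, RegUOT.eintegral η (RegUOT.H c ε p)
          + (RegUOT.defect (ENNReal.ofReal ε) p μ₀ μ₁ ν η : EReal)) ∧
    (ε ≤ 1 → RegUOT.UOT c ε μ₀ μ₁ ν =
        ⨅ η ∈ RegUOT.SLe p μ₀ μ₁ ν, RegUOT.eintegral η (RegUOT.H c ε p)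
          + (RegUOT.defect 1 p μ₀ μ₁ ν η : EReal)) ∧
    RegUOT.UOT c ε μ₀ μ₁ ν =
        ⨅ η ∈ RegUOT.SEq p μ₀ μ₁ ν, RegUOT.eintegral η (RegUOT.H c ε p) := by
  obtain ⟨M, k, hk, hck⟩ := RegUOT.exists_shifted_cost hc.measurable hcb
  have hle := le_iInf₂ fun η (hη : η ∈ RegUOT.SLe p μ₀ μ₁ ν) =>
    RegUOT.UOT_le_eintegral_add_defect p hε hk hck hη
  have hge := RegUOT.iInf_SEq_le_UOT (μ₀ := μ₀) (μ₁ := μ₁) (ν := ν) hε hp hk hck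
  have hmid := fun κ => RegUOT.iInf_SLe_le_iInf_SEq (p := p) κ (RegUOT.H c ε p) μ₀ μ₁ ν
  refine ⟨le_antisymm hle ((hmid _).trans hge), fun hε1 => le_antisymm (hle.trans ?_)
    ((hmid _).trans hge), le_antisymm (hle.trans (hmid _)) hge⟩
  refine iInf₂_mono fun η _ => add_le_add_right (EReal.coe_ennreal_le_coe_ennreal_iff.2 ?_) _
  unfold RegUOT.defect
  gcongr
  exact ENNReal.ofReal_le_one.2 hε1
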